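/- Let $\mu:\mathbb{R}\to\mathbb{R}$ satisfy: $\mu(t)\ge 1$ for all $t\in\mathbb{R}$; $\mu$ is even and non-decreasing on $(0,\infty)$; $\mu(t+s)\le\mu(t)\mu(s)$ for all $s,t\in\mathbb{R}$; and $\int_{-\infty}^{\infty}\frac{\ln\mu(t)}{1+t^2}\,dt<\infty$. Let $1\le p<\infty$, and let $L_p(\mathbb{R},\mu^p)$ be the space of complex-valued measurable functions $f$ on $\mathbb{R}$ with $\|f\|_{L_p(\mathbb{R},\mu^p)}^p=\int_{-\infty}^{\infty}|f(s)|^p\mu(s)^p\,ds<\infty$. For $\sigma>0$ let $B_\sigma$ be the set of restrictions to $\mathbb{R}$ of entire functions $F$ of exponential type not exceeding $\sigma$, i.e. such that for every $\varepsilon>0$ there is $C$ with $|F(z)|\le Ce^{(\sigma+\varepsilon)|z|}$ for all $z\in\mathbb{C}$. Then there exist constants $c_n>0$, $n=0,1,2,\dots$ (depending only on $n$, $p$ and $\mu$), such that for all $\sigma\ge 1$, all $f\in L_p(\mathbb{R},\mu^p)\cap B_\sigma$ and all $n$, the derivative $f^{(n)}$ belongs to $L_p(\mathbb{R},\mu^p)$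 and $$\|f^{(n)}\|_{L_p(\mathbb{R},\mu^p)}\le c_n\,\sigma^n\,\|f\|_{L_p(\mathbb{R},\mu^p)}.$$ -/

import Mathlib

open MeasureTheory

/-- The admissible weights: `μ ≥ 1`, even, non-decreasing on the positive half-line,
submultiplicative, and non-quasianalytic, `∫ ln μ(t) / (1 + t²) dt < ∞`.
(The integrand is nonnegative, and measurable since `μ` is even and monotone for `t > 0`,
so integrability says precisely that the integral is finite.) -/
structure IsNonquasianalyticWeight (μ : ℝ → ℝ) : Prop where
  one_le : ∀ t, 1 ≤ μ t
  even : ∀ t, μ (-t) = μ t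
  monotoneOn : MonotoneOn μ (Set.Ioi 0)
  submul : ∀ s t, μ (t + s) ≤ μ t * μ s
  integrable_log : Integrable (fun t : ℝ => Real.log (μ t) / (1 + t ^ 2))

/-- The measure `μ(s)^p ds` on the real line, so that `L_p(ℝ, μ^p)` consists of the functions
`f` with `MemLp f p (weightedVolume μ p)` and its norm is `eLpNorm f p (weightedVolume μ p)`. -/
noncomputable def weightedVolume (μ : ℝ → ℝ) (p : ℝ) : Measure ℝ :=
  volume.withDensity (fun s : ℝ => ENNReal.ofReal (μ s ^ p))

/-- `F` is an entire function of exponential type not exceeding `σ`. -/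
def IsEntireOfExpType (σ : ℝ) (F : ℂ → ℂ) : Prop :=
  Differentiable ℂ F ∧
    ∀ ε : ℝ, 0 < ε → ∃ C : ℝ, ∀ z : ℂ, ‖F z‖ ≤ C * Real.exp ((σ + ε) * ‖z‖)

/-- The class `B_σ`: functions on the real line that are restrictions of entire functions of
exponential type not exceeding `σ`. -/
def expTypeClass (σ : ℝ) : Set (ℝ → ℂ) :=
  {f | ∃ F : ℂ → ℂ, IsEntireOfExpType σ F ∧ ∀ x : ℝ, f x = F (x : ℂ)}

/-!
The derivatives of a function of class `B_σ` again belong to `B_σ`, so it suffices to bound the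
first derivative, `‖f'‖ ≤ c σ ‖f‖`, with `c` depending only on the weight, and to iterate.

The first derivative is represented as an integral of translates of `f`. By the Phragmén–Lindelöf
principle and a contour shift, the Fourier transform of an entire function `h` of small exponential
type that is `O(1 / t²)` on the real axis is supported in `[-1, 1]`
(`fourier_eq_zero_of_one_le_abs`). Fourier inversion then gives `h'(0) = ∫ h(t) κ(t) dt` with one
integrable kernel `κ`, the Fourier transform of a test function equal to `2πis` on `[-1, 1]`
(`exists_integrable_kernel_deriv`). This is applied to `h(z) = f(x + z / τ) g(z / τ)`, where `τ` is
a multiple of `σ` and `g` is an entire multiplier of exponential type with `g(0) = 1` and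
`g'(0) = 0`:

  `f'(x) = τ ∫ f(x + t / τ) g(t / τ) κ(t) dt`.

If `|g| μ ≤ C`, then submultiplicativity of `μ` and Minkowski's inequality yield
`‖f'‖ ≤ τ C ‖κ‖₁ ‖f‖` in the weighted norm. Such multipliers exist because `μ` is
non-quasianalytic: by monotonicity the logarithmic integral dominates `∑ log μ(2ᵏ⁺¹) / 2ᵏ`, so
products of powers of `sin(az) / (az)` with `m k ≈ log μ(2ᵏ⁺¹)` factors of type `e / 2ᵏ` have
bounded type (`IsNonquasianalyticWeight.exists_multiplier`). Only finite products are used: the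
product over `k < N` controls the weight `μ(min(|t|, 2ᴺ))`, which is still submultiplicative, with
constants independent of `N`, and Fatou's lemma removes the cut-off.

The quadratic decay of `h` needs a bound for `f` on the real axis. Its averages over `[0, x]` are
bounded since `f ∈ L_p`, and this forces linear growth of `f` (`exists_norm_le_linear`), which a
factor `(sin z / z)³` in the multiplier absorbs.
-/

/-! ### The Phragmén–Lindelöf principle and linear growth on the real axis -/

open Complex Set in
theorem norm_le_mul_exp_im_of_im_nonneg {H : ℂ → ℂ} (hH : Differentiable ℂ H) {b C M : ℝ}
    (hb : 0 ≤ b) (hC : ∀ z, ‖H z‖ ≤ C * Real.exp (b * ‖z‖)) (hM : ∀ x : ℝ, ‖H x‖ ≤ M)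
    {z : ℂ} (hz : 0 ≤ z.im) : ‖H z‖ ≤ max C M * Real.exp (b * z.im) := by
  -- the factor makes `K` bounded on the positive imaginary half-axis
  set K : ℂ → ℂ := fun z => H z * exp (I * b * z) with hK
  have hKd : Differentiable ℂ K := by fun_prop
  have hKn : ∀ z, ‖K z‖ = ‖H z‖ * Real.exp (-(b * z.im)) := by
    intro z
    simp [hK, norm_exp, mul_assoc]
  have hC0 : 0 ≤ C := by simpa using (norm_nonneg _).trans (hC 0)
  have hgrowth : ∀ z, ‖K z‖ ≤ C * Real.exp (2 * b * ‖z‖ ^ (1 : ℝ)) := by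
    intro z
    rw [hKn, Real.rpow_one]
    calc ‖H z‖ * Real.exp (-(b * z.im))
        ≤ (C * Real.exp (b * ‖z‖)) * Real.exp (b * ‖z‖) := by
          have : -z.im ≤ ‖z‖ := (neg_le_abs _).trans (abs_im_le_norm z)
          gcongr
          · exact hC z
          · nlinarith
      _ = _ := by rw [mul_assoc, ← Real.exp_add]; ring_nf
  have hO : ∀ l : Filter ℂ, ∃ c < (2 : ℝ), ∃ B, K =O[l] fun z => Real.exp (B * ‖z‖ ^ c) := by
    intro l
    refine ⟨1, by norm_num, 2 * b, Asymptotics.IsBigO.of_bound C (.of_forall fun z => ?_)⟩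
    simpa using hgrowth z
  have hre : ∀ x : ℝ, ‖K x‖ ≤ max C M := by
    intro x
    rw [hKn]
    simpa using Or.inr (hM x)
  have him : ∀ x : ℝ, 0 ≤ x → ‖K (x * I)‖ ≤ max C M := by
    intro x hx
    rw [hKn]
    refine le_max_of_le_left ?_
    have h := hC (x * I)
    simp only [norm_mul, norm_real, norm_I, mul_one, Real.norm_eq_abs, abs_of_nonneg hx] at h
    simp only [mul_im, ofReal_re, I_im, mul_one, ofReal_im, I_re, mul_zero, add_zero]
    calc ‖H (x * I)‖ * Real.exp (-(b * x))
        ≤ (C * Real.exp (b * x)) * Real.exp (-(b * x)) := by gcongr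
      _ = C := by rw [mul_assoc, ← Real.exp_add]; simp
  have key : ‖K z‖ ≤ max C M := by
    rcases le_total 0 z.re with h | h
    · exact PhragmenLindelof.quadrant_I hKd.diffContOnCl (hO _) (fun x _ => hre x) him h hz
    · exact PhragmenLindelof.quadrant_II hKd.diffContOnCl (hO _) (fun x _ => hre x) him h hz
  rw [hKn, Real.exp_neg, ← div_eq_mul_inv, div_le_iff₀ (Real.exp_pos _)] at key
  exact key

/-- An entire function of exponential growth that is bounded on the real axis grows
exponentially only in the imaginary direction. -/
theorem norm_le_mul_exp_abs_im {H : ℂ → ℂ} (hH : Differentiable ℂ H) {b C M : ℝ}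
    (hb : 0 ≤ b) (hC : ∀ z, ‖H z‖ ≤ C * Real.exp (b * ‖z‖)) (hM : ∀ x : ℝ, ‖H x‖ ≤ M)
    (z : ℂ) : ‖H z‖ ≤ max C M * Real.exp (b * |z.im|) := by
  rcases le_total 0 z.im with h | h
  · rw [abs_of_nonneg h]
    exact norm_le_mul_exp_im_of_im_nonneg hH hb hC hM h
  · rw [abs_of_nonpos h]
    have := norm_le_mul_exp_im_of_im_nonneg (H := fun w => H (-w)) (by fun_prop) hb
      (fun w => by simpa using hC (-w)) (fun x => by simpa using hM (-x)) (z := -z) (by simpa)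
    simpa using this

/-- Mean value bound for the difference quotient at the origin of an entire function whose
derivative has exponential growth. -/
theorem norm_dslope_zero_le {P F : ℂ → ℂ} (hP : ∀ z, HasDerivAt P (F z) z) {b C : ℝ}
    (hb : 0 ≤ b) (hC : ∀ z, ‖F z‖ ≤ C * Real.exp (b * ‖z‖)) (z : ℂ) :
    ‖dslope P 0 z‖ ≤ C * Real.exp (b * ‖z‖) := by
  rcases eq_or_ne z 0 with rfl | hz
  · rw [dslope_same, (hP 0).deriv]
    exact hC 0
  · rw [dslope_of_ne _ hz, slope_def_field, norm_div, sub_zero,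
      div_le_iff₀ (norm_pos_iff.2 hz)]
    have hC0 : 0 ≤ C := by simpa using (norm_nonneg _).trans (hC 0)
    have := (convex_closedBall (0 : ℂ) ‖z‖).norm_image_sub_le_of_norm_hasDerivWithin_le
      (f := P) (f' := F) (C := C * Real.exp (b * ‖z‖)) (x := 0) (y := z)
      (fun w _ => (hP w).hasDerivWithinAt)
      (fun w hw => (hC w).trans (by
        have : ‖w‖ ≤ ‖z‖ := by simpa using hw
        gcongr)) (by simp) (by simp)
    simpa using this

theorem differentiable_dslope_zero {P : ℂ → ℂ} (hP : Differentiable ℂ P) :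
    Differentiable ℂ (dslope P 0) := by
  rw [← differentiableOn_univ] at hP ⊢
  exact (Complex.differentiableOn_dslope Filter.univ_mem).2 hP

/-- If the averages of an entire function `F` of exponential growth over the intervals from `0`
to `x` stay bounded, then `F` grows at most linearly on the real axis: with `P` a primitive of
`F`, the function `H z = (P z - P 0) / z` is entire, bounded on the real axis, hence bounded on a
strip around it, so that `H'` is bounded on the axis as well, and `F = H + z H'`. -/
theorem exists_norm_le_linear {F : ℂ → ℂ} (hF : Differentiable ℂ F) {b C M : ℝ} (hb : 0 ≤ b)
    (hC : ∀ z, ‖F z‖ ≤ C * Real.exp (b * ‖z‖))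
    (hM : ∀ x : ℝ, 1 ≤ |x| → ‖∫ t in (0 : ℝ)..x, F t‖ ≤ M * |x|) :
    ∃ K, 0 ≤ K ∧ ∀ x : ℝ, ‖F x‖ ≤ K * (1 + |x|) := by
  obtain ⟨P, hP⟩ : ∃ P : ℂ → ℂ, ∀ z, HasDerivAt P (F z) z := by
    obtain ⟨P, hP⟩ := hF.isExactOn_univ
    exact ⟨P, fun z => hP z (Set.mem_univ _)⟩
  have hPd : Differentiable ℂ P := fun z => (hP z).differentiableAt
  set H := dslope P 0 with hHdef
  have hHd : Differentiable ℂ H := differentiable_dslope_zero hPd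
  have hHC : ∀ z, ‖H z‖ ≤ C * Real.exp (b * ‖z‖) := norm_dslope_zero_le hP hb hC
  have hC0 : 0 ≤ C := by simpa using (norm_nonneg _).trans (hC 0)
  have hmul : ∀ z, z * H z = P z - P 0 := by
    intro z
    have := sub_smul_dslope P 0 z
    simpa using this
  have hFTC : ∀ x : ℝ, ∫ t in (0 : ℝ)..x, F t = P x - P 0 := by
    intro x
    have := intervalIntegral.integral_eq_sub_of_hasDerivAt (a := 0) (b := x)
      (f := fun t : ℝ => P t) (f' := fun t : ℝ => F t) (fun t _ => (hP t).comp_ofReal)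
      ((hF.continuous.comp Complex.continuous_ofReal).intervalIntegrable _ _)
    simpa using this
  have hHb : ∀ x : ℝ, ‖H x‖ ≤ max M (C * Real.exp b) := by
    intro x
    rcases le_total 1 |x| with hx | hx
    · refine le_max_of_le_left ?_
      have h1 := hM x hx
      rw [hFTC, ← hmul, norm_mul, Complex.norm_real, Real.norm_eq_abs, mul_comm M] at h1
      exact le_of_mul_le_mul_left h1 (by linarith)
    · refine le_max_of_le_right ((hHC x).trans ?_)
      rw [Complex.norm_real, Real.norm_eq_abs]
      gcongr
      nlinarith
  set B := max C (max M (C * Real.exp b)) with hB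
  have hBpos : 0 ≤ B := le_max_of_le_left hC0
  have hstrip := norm_le_mul_exp_abs_im hHd hb hHC hHb
  have hH' : ∀ x : ℝ, ‖deriv H x‖ ≤ B * Real.exp b := by
    intro x
    have := Complex.norm_deriv_le_of_forall_mem_sphere_norm_le (c := (x : ℂ)) (R := 1) (f := H)
      (C := B * Real.exp b) one_pos hHd.diffContOnCl (fun w hw => by
        refine (hstrip w).trans ?_
        have h1 : |w.im| ≤ 1 := by
          have h2 := Complex.abs_im_le_norm (w - x)
          have h3 : ‖w - x‖ = 1 := by simpa [dist_eq_norm] using hw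
          simpa [h3] using h2
        gcongr
        nlinarith)
    simpa using this
  have hFeq : ∀ z, F z = H z + z * deriv H z := by
    intro z
    have h1 : HasDerivAt (fun z => z * H z) (1 * H z + z * deriv H z) z :=
      (hasDerivAt_id z).mul (hHd z).hasDerivAt
    have h2 : HasDerivAt (fun z => z * H z) (F z) z := by
      have : (fun z => z * H z) = fun z => P z - P 0 := funext hmul
      rw [this]
      exact (hP z).sub_const _
    simpa using h2.unique h1
  refine ⟨B * Real.exp b, by positivity, fun x => ?_⟩
  rw [hFeq]
  refine (norm_add_le _ _).trans ?_
  rw [norm_mul, Complex.norm_real, Real.norm_eq_abs, mul_add, mul_one]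
  refine add_le_add ?_ ?_
  · refine ((hHb x).trans (le_max_right C _)).trans ?_
    exact le_mul_of_one_le_right hBpos (Real.one_le_exp hb)
  · rw [mul_comm]
    gcongr
    exact hH' x

/-! ### Fourier transforms of entire functions of exponential type -/

/-- Contour shift: an entire function that is `O(1 / |z|²)` in the closed lower half-plane has
integral zero over the real axis. -/
theorem integral_ofReal_eq_zero_of_norm_le {G : ℂ → ℂ} (hG : Differentiable ℂ G) {D : ℝ}
    (hD : ∀ z : ℂ, z.im ≤ 0 → (‖z‖ ^ 2 - 1) * ‖G z‖ ≤ D)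
    (hint : Integrable fun t : ℝ => G t) : ∫ t : ℝ, G t = 0 := by
  have hbound : ∀ R : ℝ, 1 < R → ‖∫ t in (-R)..R, G (t : ℂ)‖ ≤ 4 * R * D / (R ^ 2 - 1) := by
    intro R hR
    have hR2 : 0 < R ^ 2 - 1 := by nlinarith
    have hz : ∀ z : ℂ, z.im ≤ 0 → R ≤ ‖z‖ → ‖G z‖ ≤ D / (R ^ 2 - 1) := by
      intro z hz1 hz2
      rw [le_div_iff₀ hR2, mul_comm]
      refine le_trans ?_ (hD z hz1)
      gcongr
    have hrect := Complex.integral_boundary_rect_eq_zero_of_differentiableOn G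
      (⟨-R, -R⟩ : ℂ) (⟨R, 0⟩ : ℂ) hG.differentiableOn
    simp only [Complex.ofReal_zero, zero_mul, add_zero] at hrect
    have h1 : ‖∫ x in (-R)..R, G (x + (-R : ℝ) * Complex.I)‖ ≤ D / (R ^ 2 - 1) * |R - -R| := by
      refine intervalIntegral.norm_integral_le_of_norm_le_const fun x _ => hz _ ?_ ?_
      · simp; linarith
      · refine le_trans ?_ (Complex.abs_im_le_norm _)
        simp [abs_of_pos (one_pos.trans hR)]
    have h2 : ∀ S : ℝ, |S| = R → ‖∫ y in (-R)..0, G (S + y * Complex.I)‖ ≤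
        D / (R ^ 2 - 1) * |0 - -R| := by
      intro S hS
      refine intervalIntegral.norm_integral_le_of_norm_le_const fun y hy => hz _ ?_ ?_
      · rw [Set.uIoc_of_le (by linarith)] at hy
        simpa using hy.2
      · refine le_trans ?_ (Complex.abs_re_le_norm _)
        simp [hS]
    have h3 := h2 R (abs_of_pos (by linarith))
    have h4 := h2 (-R) (by rw [abs_neg, abs_of_pos (by linarith)])
    have e : ∫ t in (-R)..R, G (t : ℂ) = (∫ x in (-R)..R, G (x + (-R : ℝ) * Complex.I)) +
        Complex.I • (∫ y in (-R)..0, G ((R : ℝ) + y * Complex.I)) -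
        Complex.I • (∫ y in (-R)..0, G ((-R : ℝ) + y * Complex.I)) := by
      linear_combination -hrect
    rw [e]
    refine (norm_sub_le _ _).trans ((add_le_add_left (norm_add_le _ _) _).trans ?_)
    rw [norm_smul, norm_smul, Complex.norm_I, one_mul, one_mul]
    rw [sub_neg_eq_add, abs_of_pos (by linarith)] at h1
    rw [sub_neg_eq_add, zero_add, abs_of_pos (by linarith)] at h3 h4
    calc _ ≤ D / (R ^ 2 - 1) * (R + R) + D / (R ^ 2 - 1) * R + D / (R ^ 2 - 1) * R := by
          gcongr
      _ = _ := by ring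
  have hlim1 : Filter.Tendsto (fun R : ℝ => ∫ t in (-R)..R, G (t : ℂ)) Filter.atTop
      (nhds (∫ t : ℝ, G t)) :=
    intervalIntegral_tendsto_integral hint Filter.tendsto_neg_atTop_atBot Filter.tendsto_id
  have hlim2 : Filter.Tendsto (fun R : ℝ => ∫ t in (-R)..R, G (t : ℂ)) Filter.atTop
      (nhds 0) := by
    have hD0 : 0 ≤ D := by
      have := hD (-2 * Complex.I) (by simp)
      refine le_trans ?_ this
      have : ‖(-2 * Complex.I : ℂ)‖ = 2 := by simp
      rw [this]; positivity
    refine squeeze_zero_norm' (a := fun R => 8 * D * R⁻¹) ?_ ?_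
    · filter_upwards [Filter.eventually_ge_atTop 2] with R hR
      refine (hbound R (by linarith)).trans ?_
      have hR2 : 0 < R ^ 2 - 1 := by nlinarith
      rw [div_le_iff₀ hR2]
      have : 8 * D * R⁻¹ * (R ^ 2 - 1) - 4 * R * D = D * (4 * R ^ 2 - 8) * R⁻¹ := by
        field_simp; ring
      have h5 : 0 ≤ D * (4 * R ^ 2 - 8) * R⁻¹ := by
        have : 0 ≤ 4 * R ^ 2 - 8 := by nlinarith
        positivity
      linarith
    · simpa using tendsto_inv_atTop_zero.const_mul (8 * D)
  exact tendsto_nhds_unique hlim1 hlim2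

theorem integrable_of_one_add_sq_mul_norm_le {u : ℝ → ℂ} (hu : Continuous u) {M : ℝ}
    (hM : ∀ t : ℝ, (1 + t ^ 2) * ‖u t‖ ≤ M) : Integrable u := by
  refine (integrable_inv_one_add_sq.const_mul M).mono' hu.aestronglyMeasurable
    (.of_forall fun t => ?_)
  rw [← div_eq_mul_inv, le_div_iff₀ (by positivity), mul_comm]
  exact hM t

open Real FourierTransform in
/-- Multiplied by `exp (-2πisz)`, the function still decays like `1 / |z|²` in the lower
half-plane, since `2πs > 3`; hence its integral vanishes. -/
theorem fourier_eq_zero_of_one_le {h : ℂ → ℂ} (hh : Differentiable ℂ h) {C M : ℝ}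
    (hC : ∀ z, ‖h z‖ ≤ C * Real.exp (2 * ‖z‖)) (hM : ∀ t : ℝ, (1 + t ^ 2) * ‖h t‖ ≤ M)
    {s : ℝ} (hs : 1 ≤ s) : 𝓕 (fun t : ℝ => h t) s = 0 := by
  have hC0 : 0 ≤ C := by simpa using (norm_nonneg _).trans (hC 0)
  have hHC : ∀ z : ℂ, ‖(1 + z ^ 2) * h z‖ ≤ 2 * C * Real.exp (3 * ‖z‖) := by
    intro z
    rw [norm_mul]
    have h1 : ‖1 + z ^ 2‖ ≤ 2 * Real.exp ‖z‖ := by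
      refine (norm_add_le _ _).trans ?_
      rw [norm_one, norm_pow]
      have := Real.quadratic_le_exp_of_nonneg (norm_nonneg z)
      nlinarith [norm_nonneg z]
    calc ‖1 + z ^ 2‖ * ‖h z‖ ≤ (2 * Real.exp ‖z‖) * (C * Real.exp (2 * ‖z‖)) := by
          gcongr; exact hC z
      _ = 2 * C * (Real.exp ‖z‖ * Real.exp (2 * ‖z‖)) := by ring
      _ = _ := by rw [← Real.exp_add]; ring_nf
  have hHM : ∀ x : ℝ, ‖(1 + (x : ℂ) ^ 2) * h x‖ ≤ M := by
    intro x
    rw [norm_mul]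
    have : ‖(1 + (x : ℂ) ^ 2)‖ = 1 + x ^ 2 := by
      rw [← Complex.ofReal_pow, ← Complex.ofReal_one, ← Complex.ofReal_add, Complex.norm_real,
        Real.norm_of_nonneg (by positivity)]
    rw [this]
    exact hM x
  have hPL := norm_le_mul_exp_abs_im (H := fun z => (1 + z ^ 2) * h z) (by fun_prop)
    (by norm_num) hHC hHM
  set D := max (2 * C) M
  have hD0 : 0 ≤ D := le_max_of_le_left (by positivity)
  have hint := integrable_of_one_add_sq_mul_norm_le
    (hh.continuous.comp Complex.continuous_ofReal) hM
  rw [Real.fourier_real_eq_integral_exp_smul]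
  set G : ℂ → ℂ := fun z => Complex.exp (-2 * π * s * Complex.I * z) * h z with hGdef
  have hGd : Differentiable ℂ G := by fun_prop
  have hGt : ∀ t : ℝ, Complex.exp (↑(-2 * π * t * s) * Complex.I) • h t = G t := by
    intro t
    simp only [hGdef, smul_eq_mul]
    push_cast
    ring_nf
  have hGn : ∀ z, ‖G z‖ = Real.exp (2 * π * s * z.im) * ‖h z‖ := by
    intro z
    rw [hGdef, norm_mul, Complex.norm_exp]
    congr 2
    simp [Complex.mul_re, Complex.mul_im]
  simp_rw [hGt]
  refine integral_ofReal_eq_zero_of_norm_le hGd (D := D) ?_ ?_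
  · intro z hz
    have h1 := hPL z
    rw [norm_mul, abs_of_nonpos hz] at h1
    have h2 : ‖z‖ ^ 2 - 1 ≤ ‖1 + z ^ 2‖ := by
      have := norm_sub_norm_le (z ^ 2) (-1)
      rw [norm_neg, norm_one, norm_pow, sub_neg_eq_add, add_comm (z ^ 2)] at this
      exact this
    rw [hGn]
    calc (‖z‖ ^ 2 - 1) * (Real.exp (2 * π * s * z.im) * ‖h z‖)
        ≤ ‖1 + z ^ 2‖ * (Real.exp (2 * π * s * z.im) * ‖h z‖) := by gcongr
      _ = Real.exp (2 * π * s * z.im) * (‖1 + z ^ 2‖ * ‖h z‖) := by ring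
      _ ≤ Real.exp (2 * π * s * z.im) * (D * Real.exp (3 * -z.im)) := by gcongr
      _ = D * Real.exp ((2 * π * s - 3) * z.im) := by
          rw [mul_left_comm, ← Real.exp_add]; ring_nf
      _ ≤ D * 1 := by
          gcongr
          rw [Real.exp_le_one_iff]
          have : 0 ≤ 2 * π * s - 3 := by nlinarith [Real.pi_gt_three]
          nlinarith
      _ = D := mul_one D
  · refine hint.mono (hGd.continuous.comp Complex.continuous_ofReal).aestronglyMeasurable
      (.of_forall fun t => ?_)
    rw [hGn]
    simp

open Real FourierTransform in
/-- The easy half of the Paley–Wiener theorem: the Fourier transform of an entire function of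
exponential type with quadratic decay on the real axis has bounded support. -/
theorem fourier_eq_zero_of_one_le_abs {h : ℂ → ℂ} (hh : Differentiable ℂ h) {C M : ℝ}
    (hC : ∀ z, ‖h z‖ ≤ C * Real.exp (2 * ‖z‖)) (hM : ∀ t : ℝ, (1 + t ^ 2) * ‖h t‖ ≤ M)
    {s : ℝ} (hs : 1 ≤ |s|) : 𝓕 (fun t : ℝ => h t) s = 0 := by
  rcases le_abs.1 hs with hs | hs
  · exact fourier_eq_zero_of_one_le hh hC hM hs
  · rw [← fourier_eq_zero_of_one_le (h := fun z => h (-z)) (by fun_prop)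
      (fun z => by simpa using hC (-z)) (fun t => by simpa using hM (-t)) hs,
      Real.fourier_real_eq_integral_exp_smul, Real.fourier_real_eq_integral_exp_smul,
      ← integral_neg_eq_self]
    simp

open Real FourierTransform ContDiff in
/-- There is an integrable kernel that represents the derivative at the origin of every entire
function of exponential type at most `2` with quadratic decay on the real axis. It is the Fourier
transform of a smooth compactly supported function equal to `2πis` for `|s| ≤ 1`. -/
theorem exists_integrable_kernel_deriv :
    ∃ κ : ℝ → ℂ, Integrable κ ∧ Continuous κ ∧ ∀ (h : ℂ → ℂ) (C M : ℝ), Differentiable ℂ h →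
      (∀ z, ‖h z‖ ≤ C * Real.exp (2 * ‖z‖)) → (∀ t : ℝ, (1 + t ^ 2) * ‖h t‖ ≤ M) →
      deriv h 0 = ∫ t : ℝ, h t * κ t := by
  let φ : ContDiffBump (0 : ℝ) := ⟨1, 2, one_pos, one_lt_two⟩
  have hψc : HasCompactSupport (fun s : ℝ => (2 * π * Complex.I * s) * (φ s : ℂ)) := by
    refine HasCompactSupport.mul_left ?_
    exact φ.hasCompactSupport.comp_left Complex.ofReal_zero
  have hψs : ContDiff ℝ ∞ (fun s : ℝ => (2 * π * Complex.I * s) * (φ s : ℂ)) := by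
    have h1 : ContDiff ℝ ∞ (fun s : ℝ => (φ s : ℂ)) :=
      Complex.ofRealCLM.contDiff.comp φ.contDiff
    have h2 : ContDiff ℝ ∞ (fun s : ℝ => (s : ℂ)) := Complex.ofRealCLM.contDiff
    exact (contDiff_const.mul h2).mul h1
  set ψ := hψc.toSchwartzMap hψs with hψ
  have hψa : ∀ s : ℝ, ψ s = (2 * π * Complex.I * s) * (φ s : ℂ) := fun s => rfl
  refine ⟨𝓕 (ψ : ℝ → ℂ), ?_, ?_, ?_⟩
  · rw [← SchwartzMap.fourier_coe]
    exact (𝓕 ψ).integrable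
  · rw [← SchwartzMap.fourier_coe]
    exact (𝓕 ψ).continuous
  intro h C M hh hC hM
  have hc : Continuous fun t : ℝ => h t := hh.continuous.comp Complex.continuous_ofReal
  have hint := integrable_of_one_add_sq_mul_norm_le hc hM
  have hzero : ∀ s : ℝ, 1 ≤ |s| → 𝓕 (fun t : ℝ => h t) s = 0 :=
    fun s hs => fourier_eq_zero_of_one_le_abs hh hC hM hs
  set g := 𝓕 (fun t : ℝ => h t) with hg
  have hgc : Continuous g :=
    VectorFourier.fourierIntegral_continuous Real.continuous_fourierChar (by fun_prop) hint
  have hgs : HasCompactSupport g := by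
    refine HasCompactSupport.intro (isCompact_Icc (a := (-1 : ℝ)) (b := 1)) fun s hs => ?_
    refine hzero s ?_
    by_contra hlt
    exact hs (abs_le.1 (not_le.1 hlt).le)
  have hgi : Integrable g := hgc.integrable_of_hasCompactSupport hgs
  have hgi' : Integrable fun s : ℝ => s • g s :=
    (continuous_id.smul hgc).integrable_of_hasCompactSupport hgs.smul_left
  have hinv : ∀ x : ℝ, 𝓕 g (-x) = h x := by
    intro x
    rw [← Real.fourierInv_eq_fourier_neg]
    exact congrFun (hc.fourierInv_fourier_eq hint hgi) x
  have hd1 : HasDerivAt (fun x : ℝ => h x)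
      (-(𝓕 (fun x : ℝ ↦ (-2 * π * Complex.I * x) • g x) (-0))) 0 := by
    have h1 := (Real.hasDerivAt_fourier hgi hgi' (-0)).scomp (0 : ℝ) (hasDerivAt_neg (0 : ℝ))
    have : (𝓕 g ∘ Neg.neg) = fun x : ℝ => h x := funext hinv
    rw [this] at h1
    simpa using h1
  have hd2 : HasDerivAt (fun x : ℝ => h x) (deriv h 0) 0 := by
    have := (hh (0 : ℝ)).hasDerivAt.comp_ofReal
    simpa using this
  rw [hd2.unique hd1, neg_zero, Real.fourier_real_eq_integral_exp_smul, ← integral_neg]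
  have hflip := VectorFourier.integral_fourierIntegral_smul_eq_flip (μ := volume) (ν := volume)
    (L := innerₗ ℝ) Real.continuous_fourierChar (by fun_prop) hint ψ.integrable
  have hflip' : ∫ s : ℝ, g s * ψ s = ∫ t : ℝ, h t * 𝓕 (ψ : ℝ → ℂ) t := by
    rw [flip_innerₗ] at hflip
    exact hflip
  rw [← hflip']
  congr 1
  ext s
  rcases le_total 1 |s| with hs | hs
  · simp [hzero s hs]
  · have : φ s = 1 := φ.one_of_mem_closedBall (by simpa using hs)
    rw [hψa, this]
    simp
    ring

/-! ### Entire multipliers for a non-quasianalytic weight -/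

/-- The entire function `sin z / z`, with value `1` at the origin. -/
noncomputable def entireSinc : ℂ → ℂ := dslope Complex.sin 0

theorem differentiable_entireSinc : Differentiable ℂ entireSinc :=
  differentiable_dslope_zero Complex.differentiable_sin

theorem entireSinc_zero : entireSinc 0 = 1 := by
  simp [entireSinc, dslope_same]

theorem mul_entireSinc (z : ℂ) : z * entireSinc z = Complex.sin z := by
  have := sub_smul_dslope Complex.sin 0 z
  simpa [entireSinc] using this

theorem entireSinc_neg (z : ℂ) : entireSinc (-z) = entireSinc z := by
  rcases eq_or_ne z 0 with rfl | hz
  · simp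
  · have h1 := mul_entireSinc (-z)
    rw [Complex.sin_neg, ← mul_entireSinc z] at h1
    exact mul_left_cancel₀ hz (by linear_combination -h1)

theorem norm_entireSinc_le (z : ℂ) : ‖entireSinc z‖ ≤ Real.exp ‖z‖ := by
  have hcos : ∀ w : ℂ, ‖Complex.cos w‖ ≤ 1 * Real.exp (1 * ‖w‖) := by
    intro w
    rw [Complex.cos, norm_div, Complex.norm_ofNat, one_mul, one_mul, div_le_iff₀ two_pos]
    refine (norm_add_le _ _).trans ?_
    have h1 : ∀ v : ℂ, ‖v‖ = ‖w‖ → ‖Complex.exp v‖ ≤ Real.exp ‖w‖ := by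
      intro v hv
      rw [Complex.norm_exp, ← hv]
      exact Real.exp_le_exp.2 ((le_abs_self _).trans (Complex.abs_re_le_norm v))
    have h2 := h1 (w * Complex.I) (by simp)
    have h3 := h1 (-w * Complex.I) (by simp)
    linarith
  simpa [entireSinc] using norm_dslope_zero_le Complex.hasDerivAt_sin zero_le_one hcos z

theorem abs_mul_norm_entireSinc_le (x : ℝ) : |x| * ‖entireSinc x‖ ≤ 1 := by
  rw [← Real.norm_eq_abs, ← Complex.norm_real, ← norm_mul, mul_entireSinc, ← Complex.ofReal_sin,
    Complex.norm_real]
  exact Real.abs_sin_le_one x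

theorem norm_entireSinc_ofReal_le_one (x : ℝ) : ‖entireSinc x‖ ≤ 1 := by
  rcases eq_or_ne x 0 with rfl | hx
  · simp [entireSinc_zero]
  · have h : |x| * ‖entireSinc x‖ ≤ |x| * 1 := by
      rw [← Real.norm_eq_abs, ← Complex.norm_real, ← norm_mul, mul_entireSinc,
        ← Complex.ofReal_sin, Complex.norm_real, mul_one, Complex.norm_real]
      exact Real.abs_sin_le_abs
    exact le_of_mul_le_mul_left h (abs_pos.2 hx)

/-- The product `S(z)³ ∏_{k < N} S(e z / 2ᵏ) ^ m k` with `S z = sin z / z`: an even entire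
function of exponential type at most `3 + e ∑ m k / 2ᵏ`, whose `k`-th factor is at most
`exp (- m k)` for real `z` with `|z| ≥ 2ᵏ`. -/
noncomputable def sincProduct (m : ℕ → ℕ) (N : ℕ) (z : ℂ) : ℂ :=
  entireSinc z ^ 3 *
    ∏ k ∈ Finset.range N, entireSinc ((Real.exp 1 / 2 ^ k : ℝ) * z) ^ m k

section sincProduct
variable (m : ℕ → ℕ) (N : ℕ)

theorem differentiable_sincProduct : Differentiable ℂ (sincProduct m N) := by
  have h := differentiable_entireSinc
  unfold sincProduct
  fun_prop

theorem sincProduct_zero : sincProduct m N 0 = 1 := by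
  simp [sincProduct, entireSinc_zero]

theorem deriv_sincProduct_zero : deriv (sincProduct m N) 0 = 0 := by
  have heven : (fun z => sincProduct m N (-z)) = sincProduct m N := by
    ext z
    simp [sincProduct, entireSinc_neg]
  have h := deriv_comp_neg (sincProduct m N) 0
  rw [heven, neg_zero] at h
  linear_combination h / 2

theorem norm_sincProduct_le (z : ℂ) : ‖sincProduct m N z‖ ≤
    Real.exp ((3 + ∑ k ∈ Finset.range N, m k * (Real.exp 1 / 2 ^ k)) * ‖z‖) := by
  rw [sincProduct, norm_mul, norm_pow, norm_prod, add_mul, Real.exp_add, Finset.sum_mul,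
    Real.exp_sum]
  gcongr with k hk
  · refine (pow_le_pow_left₀ (norm_nonneg _) (norm_entireSinc_le z) 3).trans_eq ?_
    rw [← Real.exp_nat_mul]
    norm_num
  · rw [norm_pow]
    refine (pow_le_pow_left₀ (norm_nonneg _) (norm_entireSinc_le _) _).trans_eq ?_
    rw [← Real.exp_nat_mul, norm_mul, Complex.norm_real, Real.norm_of_nonneg (by positivity),
      mul_assoc]

theorem norm_entireSinc_factor_le_one (k : ℕ) (t : ℝ) :
    ‖entireSinc ((Real.exp 1 / 2 ^ k : ℝ) * (t : ℂ)) ^ m k‖ ≤ 1 := by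
  rw [norm_pow, ← Complex.ofReal_mul]
  exact pow_le_one₀ (norm_nonneg _) (norm_entireSinc_ofReal_le_one _)

theorem norm_sincProduct_ofReal_le_pow (t : ℝ) :
    ‖sincProduct m N t‖ ≤ ‖entireSinc t‖ ^ 3 := by
  rw [sincProduct, norm_mul, norm_pow, norm_prod]
  refine mul_le_of_le_one_right (by positivity) ?_
  exact Finset.prod_le_one (fun _ _ => norm_nonneg _)
    fun k _ => norm_entireSinc_factor_le_one m k t

theorem norm_sincProduct_ofReal_le_one (t : ℝ) : ‖sincProduct m N t‖ ≤ 1 :=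
  (norm_sincProduct_ofReal_le_pow m N t).trans
    (pow_le_one₀ (norm_nonneg _) (norm_entireSinc_ofReal_le_one _))

theorem pow_mul_norm_sincProduct_ofReal_le_one (t : ℝ) : |t| ^ 3 * ‖sincProduct m N t‖ ≤ 1 := by
  calc |t| ^ 3 * ‖sincProduct m N t‖ ≤ |t| ^ 3 * ‖entireSinc t‖ ^ 3 := by
        gcongr; exact norm_sincProduct_ofReal_le_pow m N t
    _ = (|t| * ‖entireSinc t‖) ^ 3 := by ring
    _ ≤ 1 := pow_le_one₀ (by positivity) (abs_mul_norm_entireSinc_le t)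

theorem norm_sincProduct_ofReal_le_exp {k : ℕ} (hk : k < N) {t : ℝ} (ht : 2 ^ k ≤ |t|) :
    ‖sincProduct m N t‖ ≤ Real.exp (-(m k : ℝ)) := by
  rw [sincProduct, norm_mul, norm_pow, norm_prod]
  refine (mul_le_of_le_one_left (Finset.prod_nonneg fun _ _ => norm_nonneg _)
    (pow_le_one₀ (norm_nonneg _) (norm_entireSinc_ofReal_le_one _))).trans ?_
  rw [← Finset.mul_prod_erase _ _ (Finset.mem_range.2 hk)]
  refine (mul_le_of_le_one_right (norm_nonneg _) (Finset.prod_le_one (fun _ _ => norm_nonneg _)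
    fun j _ => norm_entireSinc_factor_le_one m j t)).trans ?_
  have h1 := abs_mul_norm_entireSinc_le (Real.exp 1 / 2 ^ k * t)
  rw [Complex.ofReal_mul] at h1
  set v := ‖entireSinc ((Real.exp 1 / 2 ^ k : ℝ) * (t : ℂ))‖ with hv
  have h2 : Real.exp 1 ≤ |Real.exp 1 / 2 ^ k * t| := by
    rw [abs_mul, abs_of_pos (by positivity), div_mul_eq_mul_div, le_div_iff₀ (by positivity)]
    gcongr
  have h3 : v ≤ Real.exp (-1) := by
    rw [Real.exp_neg, ← one_div, le_div_iff₀ (Real.exp_pos 1), mul_comm]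
    refine le_trans ?_ h1
    gcongr
  rw [norm_pow, ← hv]
  refine (pow_le_pow_left₀ (norm_nonneg _) h3 _).trans_eq ?_
  rw [← Real.exp_nat_mul]
  simp

end sincProduct

namespace IsNonquasianalyticWeight
variable {μ : ℝ → ℝ}

theorem pos (hμ : IsNonquasianalyticWeight μ) (t : ℝ) : 0 < μ t := one_pos.trans_le (hμ.one_le t)

theorem log_nonneg (hμ : IsNonquasianalyticWeight μ) (t : ℝ) : 0 ≤ Real.log (μ t) := Real.log_nonneg (hμ.one_le t)

theorem apply_abs (hμ : IsNonquasianalyticWeight μ) (t : ℝ) : μ |t| = μ t := by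
  rcases abs_choice t with h | h <;> rw [h]
  exact hμ.even t

theorem apply_zero_le (hμ : IsNonquasianalyticWeight μ) (t : ℝ) : μ 0 ≤ μ t * μ t := by
  simpa [hμ.even] using hμ.submul t (-t)

/-- Condensation of the logarithmic integral over dyadic intervals, on each of which `log μ` is
at least its value at the left endpoint. -/
theorem sum_log_le (hμ : IsNonquasianalyticWeight μ) (N : ℕ) : ∑ k ∈ Finset.range N, Real.log (μ (2 ^ (k + 1))) / 2 ^ k ≤
    16 * ∫ t, Real.log (μ t) / (1 + t ^ 2) := by
  set φ : ℝ → ℝ := fun t => Real.log (μ t) / (1 + t ^ 2) with hφ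
  have hφ0 : ∀ t, 0 ≤ φ t := fun t => div_nonneg (hμ.log_nonneg t) (by positivity)
  have hterm : ∀ k : ℕ, Real.log (μ (2 ^ (k + 1))) / 2 ^ k ≤
      16 * ∫ t in (2 ^ (k + 1) : ℝ)..2 ^ (k + 1 + 1), φ t := by
    intro k
    have hle : (2 : ℝ) ^ (k + 1) ≤ 2 ^ (k + 1 + 1) := by gcongr <;> norm_num
    have h1 : ∫ t in (2 ^ (k + 1) : ℝ)..2 ^ (k + 1 + 1),
        Real.log (μ (2 ^ (k + 1))) / (8 * (2 ^ (k + 1)) ^ 2) ≤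
        ∫ t in (2 ^ (k + 1) : ℝ)..2 ^ (k + 1 + 1), φ t := by
      refine intervalIntegral.integral_mono_on hle (by simp)
        hμ.integrable_log.intervalIntegrable fun t ht => ?_
      have h2 : (0 : ℝ) < 2 ^ (k + 1) := by positivity
      have h3 : (1 : ℝ) ≤ 2 ^ (k + 1) := one_le_pow₀ (by norm_num)
      have h4 : t ≤ 2 * 2 ^ (k + 1) := by have := ht.2; rw [pow_succ _ (k + 1)] at this; linarith
      have h5 : 0 < t := h2.trans_le ht.1
      refine div_le_div₀ (hμ.log_nonneg t) ?_ (by positivity) ?_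
      · exact Real.log_le_log (hμ.pos _) (hμ.monotoneOn h2 h5 ht.1)
      · nlinarith
    rw [intervalIntegral.integral_const, smul_eq_mul] at h1
    have h6 : ((2 : ℝ) ^ (k + 1 + 1) - 2 ^ (k + 1)) *
        (Real.log (μ (2 ^ (k + 1))) / (8 * (2 ^ (k + 1)) ^ 2)) =
        Real.log (μ (2 ^ (k + 1))) / 2 ^ k / 16 := by
      generalize Real.log (μ (2 ^ (k + 1))) = L
      rw [pow_succ _ (k + 1), pow_succ _ k]
      have : (2 : ℝ) ^ k ≠ 0 := by positivity
      field_simp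
      ring
    linarith
  calc ∑ k ∈ Finset.range N, Real.log (μ (2 ^ (k + 1))) / 2 ^ k
      ≤ ∑ k ∈ Finset.range N, 16 * ∫ t in (2 ^ (k + 1) : ℝ)..2 ^ (k + 1 + 1), φ t :=
        Finset.sum_le_sum fun k _ => hterm k
    _ = 16 * ∫ t in (2 ^ (0 + 1) : ℝ)..2 ^ (N + 1), φ t := by
        rw [← Finset.mul_sum,
          intervalIntegral.sum_integral_adjacent_intervals (a := fun k : ℕ => (2 : ℝ) ^ (k + 1))]
        intro k _
        exact hμ.integrable_log.intervalIntegrable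
    _ ≤ 16 * ∫ t, φ t := by
        gcongr
        rw [intervalIntegral.integral_of_le (by gcongr <;> norm_num)]
        exact setIntegral_le_integral hμ.integrable_log (.of_forall hφ0)

/-- Entire multipliers compensating the growth of the weight. The exponential type `A` and the
bound `C` do not depend on the level `2 ^ N` at which the weight is cut off. -/
theorem exists_multiplier (hμ : IsNonquasianalyticWeight μ) : ∃ A C : ℝ, 0 ≤ A ∧ 0 ≤ C ∧ ∀ N : ℕ, ∃ g : ℂ → ℂ,
    Differentiable ℂ g ∧ (∀ z, ‖g z‖ ≤ Real.exp (A * ‖z‖)) ∧ g 0 = 1 ∧ deriv g 0 = 0 ∧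
    (∀ t : ℝ, ‖g t‖ ≤ 1) ∧ (∀ t : ℝ, |t| ^ 3 * ‖g t‖ ≤ 1) ∧
    ∀ t : ℝ, ‖g t‖ * μ (min |t| (2 ^ N)) ≤ C := by
  set I := ∫ t, Real.log (μ t) / (1 + t ^ 2) with hI
  have hI0 : 0 ≤ I := integral_nonneg fun t => div_nonneg (hμ.log_nonneg t) (by positivity)
  -- then `exp (- m k)` compensates `μ` on the interval `(2 ^ k, 2 ^ (k + 1)]`
  set m : ℕ → ℕ := fun k => ⌈Real.log (μ (2 ^ (k + 1)))⌉₊ with hm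
  have hμ1 : μ 1 ≤ μ 1 * μ 1 := le_mul_of_one_le_left (hμ.pos 1).le (hμ.one_le 1)
  refine ⟨3 + Real.exp 1 * (16 * I + 2), μ 1 * μ 1, by positivity,
    mul_self_nonneg _, fun N => ⟨sincProduct m N, differentiable_sincProduct m N, fun z => ?_,
    sincProduct_zero m N, deriv_sincProduct_zero m N, norm_sincProduct_ofReal_le_one m N,
    pow_mul_norm_sincProduct_ofReal_le_one m N, fun t => ?_⟩⟩
  · refine (norm_sincProduct_le m N z).trans ?_
    gcongr
    have hgeom : ∑ k ∈ Finset.range N, (1 : ℝ) / 2 ^ k ≤ 2 := by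
      have := sum_geometric_two_le N
      simpa using this
    calc ∑ k ∈ Finset.range N, m k * (Real.exp 1 / 2 ^ k)
        ≤ ∑ k ∈ Finset.range N,
            Real.exp 1 * (Real.log (μ (2 ^ (k + 1))) / 2 ^ k + 1 / 2 ^ k) := by
          refine Finset.sum_le_sum fun k _ => ?_
          have := (Nat.ceil_lt_add_one (hμ.log_nonneg (2 ^ (k + 1)))).le
          calc m k * (Real.exp 1 / 2 ^ k)
              ≤ (Real.log (μ (2 ^ (k + 1))) + 1) * (Real.exp 1 / 2 ^ k) := by gcongr
            _ = _ := by ring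
      _ ≤ _ := by
          rw [← Finset.mul_sum, Finset.sum_add_distrib]
          gcongr
          exact hμ.sum_log_le N
  · set s := min |t| (2 ^ N) with hs
    have hs0 : 0 ≤ s := le_min (abs_nonneg t) (by positivity)
    rcases le_or_gt s 1 with h1 | h1
    · have h2 : μ s ≤ μ 1 * μ 1 := by
        rcases hs0.eq_or_lt with h0 | h0
        · rw [← h0]; exact hμ.apply_zero_le 1
        · exact (hμ.monotoneOn h0 (Set.mem_Ioi.2 one_pos) h1).trans hμ1
      exact (mul_le_of_le_one_left (hμ.pos _).le (norm_sincProduct_ofReal_le_one m N t)).trans h2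
    · -- the dyadic interval `(2 ^ j, 2 ^ (j + 1)]` containing `s`
      obtain ⟨j, hj1, hj2⟩ : ∃ j : ℕ, (2 : ℝ) ^ j < s ∧ s ≤ 2 ^ (j + 1) := by
        have hex : ∃ n : ℕ, s ≤ 2 ^ n := ⟨N, min_le_right _ _⟩
        have hpos : Nat.find hex ≠ 0 := fun h0 => by
          have := Nat.find_spec hex
          rw [h0, pow_zero] at this
          exact this.not_gt h1
        obtain ⟨j, hj⟩ := Nat.exists_eq_succ_of_ne_zero hpos
        refine ⟨j, not_le.1 (Nat.find_min hex (by lia)), ?_⟩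
        rw [← Nat.succ_eq_add_one, ← hj]
        exact Nat.find_spec hex
      have hjN : j < N := by
        have : (2 : ℝ) ^ j < 2 ^ N := hj1.trans_le (min_le_right _ _)
        exact (pow_lt_pow_iff_right₀ one_lt_two).1 this
      have hjt : (2 : ℝ) ^ j ≤ |t| := (hj1.trans_le (min_le_left _ _)).le
      have h3 := norm_sincProduct_ofReal_le_exp m N hjN hjt
      have h4 : μ s ≤ Real.exp (m j) := by
        refine (hμ.monotoneOn (one_pos.trans h1) (by simp) hj2).trans ?_
        rw [← Real.exp_log (hμ.pos (2 ^ (j + 1)))]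
        exact Real.exp_le_exp.2 (Nat.le_ceil _)
      calc ‖sincProduct m N t‖ * μ s ≤ Real.exp (-(m j : ℝ)) * Real.exp (m j) :=
            mul_le_mul h3 h4 (hμ.pos _).le (Real.exp_pos _).le
        _ = 1 := by rw [← Real.exp_add]; simp
        _ ≤ _ := (hμ.one_le 1).trans hμ1

end IsNonquasianalyticWeight

/-! ### Truncated weights and weighted norms of integrals of translates -/

namespace IsNonquasianalyticWeight
variable {μ : ℝ → ℝ}

theorem measurable (hμ : IsNonquasianalyticWeight μ) : Measurable μ := by
  -- `μ` need not be monotone up to `0`, so the origin is treated apart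
  have hmono : Monotone fun t : ℝ => if 0 < t then μ t else 1 := by
    intro s t hst
    by_cases hs : 0 < s
    · simp only [hs, hs.trans_le hst, if_true]
      exact hμ.monotoneOn hs (hs.trans_le hst) hst
    · by_cases ht : 0 < t <;> simp [hs, ht, hμ.one_le]
  have heq : μ = fun t => if t = 0 then μ 0 else (fun t : ℝ => if 0 < t then μ t else 1) |t| := by
    ext t
    by_cases ht : t = 0
    · simp [ht]
    · simp [ht, hμ.apply_abs]
  rw [heq]
  exact Measurable.ite (measurableSet_singleton 0) measurable_const
    (hmono.measurable.comp measurable_norm)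

end IsNonquasianalyticWeight

/-- The weight `μ` made constant outside `[-R, R]`. -/
def truncatedWeight (μ : ℝ → ℝ) (R t : ℝ) : ℝ := μ (min |t| R)

namespace IsNonquasianalyticWeight
variable {μ : ℝ → ℝ} {R : ℝ}

theorem measurable_truncatedWeight (hμ : IsNonquasianalyticWeight μ) :
    Measurable (truncatedWeight μ R) :=
  hμ.measurable.comp (measurable_norm.min measurable_const)

theorem truncatedWeight_pos (hμ : IsNonquasianalyticWeight μ) (t : ℝ) :
    0 < truncatedWeight μ R t := hμ.pos _

theorem truncatedWeight_le (hμ : IsNonquasianalyticWeight μ) (hR : 0 < R) (t : ℝ) :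
    truncatedWeight μ R t ≤ μ t := by
  rw [truncatedWeight, ← hμ.apply_abs t]
  rcases eq_or_ne t 0 with rfl | ht
  · simp [hR.le]
  · have h := abs_pos.2 ht
    exact hμ.monotoneOn (lt_min h hR) h (min_le_left _ _)

theorem truncatedWeight_of_abs_le (hμ : IsNonquasianalyticWeight μ) {t : ℝ} (ht : |t| ≤ R) :
    truncatedWeight μ R t = μ t := by
  rw [truncatedWeight, min_eq_left ht, hμ.apply_abs]

theorem truncatedWeight_sub_le (hμ : IsNonquasianalyticWeight μ) (hR : 0 < R) (s t : ℝ) :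
    truncatedWeight μ R (s - t) ≤ truncatedWeight μ R s * truncatedWeight μ R t := by
  unfold truncatedWeight
  rcases eq_or_ne s t with rfl | hst
  · rw [sub_self, abs_zero, min_eq_left hR.le]
    exact hμ.apply_zero_le _
  · have h0 : 0 < min |s - t| R := lt_min (abs_pos.2 (sub_ne_zero.2 hst)) hR
    have h1 : min |s - t| R ≤ min |s| R + min |t| R := by
      have h2 : |s - t| ≤ |s| + |t| := abs_sub s t
      have h3 := abs_nonneg s
      have h4 := abs_nonneg t
      rcases min_cases |s| R with h | h <;> rcases min_cases |t| R with h' | h' <;>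
        rcases min_cases |s - t| R with h'' | h'' <;> linarith
    refine (hμ.monotoneOn h0 (h0.trans_le h1) h1).trans ?_
    exact hμ.submul _ _

end IsNonquasianalyticWeight

open scoped ENNReal

/-- Minkowski's inequality for an integral of translates, in the form of Young's inequality. -/
theorem lintegral_rpow_lintegral_translate_le {G k : ℝ → ℝ≥0∞} {u : ℝ → ℝ} (hG : Measurable G)
    (hk : Measurable k) (hu : Measurable u) {p : ℝ} (hp : 1 ≤ p) :
    ∫⁻ x, (∫⁻ t, G (x + u t) * k t) ^ p ≤ (∫⁻ t, k t) ^ p * ∫⁻ x, G x ^ p := by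
  have hp0 : 0 < p := one_pos.trans_le hp
  have hpt : ∀ x, (∫⁻ t, G (x + u t) * k t) ^ p ≤
      (∫⁻ t, k t) ^ (p - 1) * ∫⁻ t, k t * G (x + u t) ^ p := by
    intro x
    -- Hölder's inequality for the measure with density `k`
    have hGx : Measurable fun t => G (x + u t) := hG.comp (measurable_const.add hu)
    have h := eLpNorm'_le_eLpNorm'_mul_rpow_measure_univ (f := fun t => G (x + u t))
      (μ := volume.withDensity k) one_pos hp hGx.aestronglyMeasurable
    simp only [eLpNorm', enorm_eq_self, ENNReal.rpow_one, one_div, inv_one] at h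
    rw [lintegral_withDensity_eq_lintegral_mul _ hk hGx,
      lintegral_withDensity_eq_lintegral_mul _ hk (hGx.pow_const p),
      withDensity_apply _ MeasurableSet.univ, setLIntegral_univ] at h
    simp only [Pi.mul_apply] at h
    simp_rw [mul_comm (G _)]
    refine (ENNReal.rpow_le_rpow h hp0.le).trans_eq ?_
    rw [ENNReal.mul_rpow_of_nonneg _ _ hp0.le, ENNReal.rpow_inv_rpow hp0.ne',
      ← ENNReal.rpow_mul, sub_mul, one_mul, inv_mul_cancel₀ hp0.ne', mul_comm]
  have hmeas : Measurable (Function.uncurry fun x t => k t * G (x + u t) ^ p) := by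
    unfold Function.uncurry
    fun_prop
  calc ∫⁻ x, (∫⁻ t, G (x + u t) * k t) ^ p
      ≤ ∫⁻ x, (∫⁻ t, k t) ^ (p - 1) * ∫⁻ t, k t * G (x + u t) ^ p := lintegral_mono hpt
    _ = (∫⁻ t, k t) ^ (p - 1) * ∫⁻ x, ∫⁻ t, k t * G (x + u t) ^ p :=
        lintegral_const_mul _ hmeas.lintegral_prod_right'
    _ = (∫⁻ t, k t) ^ (p - 1) * ∫⁻ t, ∫⁻ x, k t * G (x + u t) ^ p := by
        rw [lintegral_lintegral_swap hmeas.aemeasurable]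
    _ = (∫⁻ t, k t) ^ (p - 1) * ∫⁻ t, k t * ∫⁻ x, G x ^ p := by
        congr 2
        ext t
        rw [lintegral_const_mul _ (by fun_prop),
          lintegral_add_right_eq_self (fun x => G x ^ p) (u t)]
    _ = (∫⁻ t, k t) ^ (p - 1) * (∫⁻ t, k t) ^ (1 : ℝ) * ∫⁻ x, G x ^ p := by
        rw [lintegral_mul_const _ hk, mul_assoc, ENNReal.rpow_one]
    _ = (∫⁻ t, k t) ^ p * ∫⁻ x, G x ^ p := by
        rw [← ENNReal.rpow_add_of_nonneg _ _ (by linarith) zero_le_one, sub_add_cancel]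

theorem eLpNorm_weightedVolume {w : ℝ → ℝ} (hw : Measurable w) (hw0 : ∀ t, 0 < w t) {p : ℝ}
    (hp : 1 ≤ p) {f : ℝ → ℂ} (hf : Measurable f) :
    eLpNorm f (ENNReal.ofReal p) (weightedVolume w p) =
      (∫⁻ x, ENNReal.ofReal (w x * ‖f x‖) ^ p) ^ (1 / p) := by
  have hp0 : 0 < p := one_pos.trans_le hp
  rw [eLpNorm_eq_lintegral_rpow_enorm_toReal (by simpa using hp0) ENNReal.ofReal_ne_top,
    ENNReal.toReal_ofReal hp0.le, weightedVolume,
    lintegral_withDensity_eq_lintegral_mul _ (hw.pow_const p).ennreal_ofReal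
      (hf.enorm.pow_const p)]
  congr 2
  ext x
  rw [Pi.mul_apply, ENNReal.ofReal_mul (hw0 x).le, ENNReal.mul_rpow_of_nonneg _ _ hp0.le,
    ENNReal.ofReal_rpow_of_nonneg (hw0 x).le hp0.le, ofReal_norm]

/-! ### The weighted Bernstein inequality -/

theorem isEntireOfExpType_deriv {σ : ℝ} {F : ℂ → ℂ} (hσ : 0 ≤ σ) (hF : IsEntireOfExpType σ F) :
    IsEntireOfExpType σ (deriv F) := by
  refine ⟨hF.1.deriv, fun ε hε => ?_⟩
  obtain ⟨C, hC⟩ := hF.2 ε hε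
  have hC0 : 0 ≤ C := by simpa using (norm_nonneg _).trans (hC 0)
  refine ⟨C * Real.exp (σ + ε), fun z => ?_⟩
  have h := Complex.norm_deriv_le_of_forall_mem_sphere_norm_le (c := z) (R := 1) (f := F)
    (C := C * Real.exp ((σ + ε) * (‖z‖ + 1))) one_pos hF.1.diffContOnCl (fun w hw => by
      refine (hC w).trans ?_
      have h1 : ‖w - z‖ = 1 := by simpa [dist_eq_norm] using hw
      have h2 : ‖w‖ ≤ ‖z‖ + 1 := by
        have := norm_add_le (w - z) z
        rw [sub_add_cancel, h1] at this
        linarith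
      gcongr)
  rw [div_one] at h
  refine h.trans_eq ?_
  rw [mul_assoc, ← Real.exp_add]
  ring_nf

theorem deriv_comp_ofReal_of_differentiable {F : ℂ → ℂ} (hF : Differentiable ℂ F) :
    deriv (fun x : ℝ => F x) = fun x : ℝ => deriv F x := by
  ext x
  exact (hF x).hasDerivAt.comp_ofReal.deriv

/-- Interpolation formula for the derivative of an entire function of exponential type with
linear growth on the real axis: the kernel representing `h' 0` is applied to
`h z = F (x + z / τ) g (z / τ)`, where the multiplier `g` provides the decay on the real axis. -/
theorem deriv_eq_integral_translates {κ : ℝ → ℂ}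
    (hκ : ∀ (h : ℂ → ℂ) (C M : ℝ), Differentiable ℂ h →
      (∀ z, ‖h z‖ ≤ C * Real.exp (2 * ‖z‖)) → (∀ t : ℝ, (1 + t ^ 2) * ‖h t‖ ≤ M) →
      deriv h 0 = ∫ t : ℝ, h t * κ t)
    {F g : ℂ → ℂ} {b B K A τ : ℝ} (hF : Differentiable ℂ F) (hb : 0 ≤ b)
    (hFB : ∀ z, ‖F z‖ ≤ B * Real.exp (b * ‖z‖)) (hK : 0 ≤ K)
    (hFK : ∀ x : ℝ, ‖F x‖ ≤ K * (1 + |x|))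
    (hg : Differentiable ℂ g) (hgA : ∀ z, ‖g z‖ ≤ Real.exp (A * ‖z‖)) (hg0 : g 0 = 1)
    (hg0' : deriv g 0 = 0) (hg1 : ∀ t : ℝ, ‖g t‖ ≤ 1) (hg3 : ∀ t : ℝ, |t| ^ 3 * ‖g t‖ ≤ 1)
    (hτ : 1 ≤ τ) (hbA : b + A ≤ 2 * τ) (x : ℝ) :
    deriv F x = τ * ∫ t : ℝ, F ↑(x + t / τ) * g ↑(t / τ) * κ t := by
  have hτ0 : 0 < τ := one_pos.trans_le hτ
  have hτC : (τ : ℂ) ≠ 0 := by exact_mod_cast hτ0.ne'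
  have hB : 0 ≤ B := by simpa using (norm_nonneg _).trans (hFB 0)
  set h : ℂ → ℂ := fun z => F (x + z / τ) * g (z / τ) with hh
  have hd : Differentiable ℂ h := by
    have h1 : Differentiable ℂ fun z : ℂ => (x : ℂ) + z / τ := by fun_prop
    have h2 : Differentiable ℂ fun z : ℂ => z / τ := by fun_prop
    exact (hF.comp h1).mul (hg.comp h2)
  have hgrowth : ∀ z, ‖h z‖ ≤ B * Real.exp (b * |x|) * Real.exp (2 * ‖z‖) := by
    intro z
    have h1 : ‖(x : ℂ) + z / τ‖ ≤ |x| + ‖z‖ / τ := by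
      refine (norm_add_le _ _).trans_eq ?_
      rw [norm_div, Complex.norm_real, Complex.norm_real, Real.norm_eq_abs,
        Real.norm_of_nonneg hτ0.le]
    have h2 := hgA (z / τ)
    rw [norm_div, Complex.norm_real, Real.norm_of_nonneg hτ0.le] at h2
    rw [hh, norm_mul]
    calc ‖F (x + z / τ)‖ * ‖g (z / τ)‖
        ≤ (B * Real.exp (b * (|x| + ‖z‖ / τ))) * Real.exp (A * (‖z‖ / τ)) := by
          refine mul_le_mul ((hFB _).trans ?_) h2 (norm_nonneg _) (by positivity)
          gcongr
      _ = B * Real.exp (b * |x|) * Real.exp ((b + A) * (‖z‖ / τ)) := by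
          rw [mul_assoc, mul_assoc, ← Real.exp_add, ← Real.exp_add]
          ring_nf
      _ ≤ _ := by
          refine mul_le_mul_of_nonneg_left (Real.exp_le_exp.2 ?_) (by positivity)
          calc (b + A) * (‖z‖ / τ) ≤ 2 * τ * (‖z‖ / τ) := by gcongr
            _ = 2 * ‖z‖ := by field_simp
  have hdecay : ∀ t : ℝ, (1 + t ^ 2) * ‖h t‖ ≤ τ ^ 2 * (K * (1 + |x|)) * 4 := by
    intro t
    set v := t / τ with hv
    have htv : t = τ * v := by rw [hv]; field_simp
    have h1 : h t = F ↑(x + v) * g v := by simp [hh, hv]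
    have h2 : ‖F ↑(x + v)‖ ≤ K * (1 + |x|) * (1 + |v|) := by
      refine (hFK _).trans ?_
      rw [mul_assoc]
      gcongr
      have := abs_add_le x v
      nlinarith [abs_nonneg x, abs_nonneg v]
    have h3 : 1 + t ^ 2 ≤ τ ^ 2 * (1 + |v| ^ 2) := by
      rw [htv, sq_abs]
      nlinarith
    have h4 : (1 + |v| ^ 2) * (1 + |v|) * ‖g v‖ ≤ 4 := by
      have h5 : (1 + |v| ^ 2) * (1 + |v|) ≤ 2 * (1 + |v| ^ 3) := by
        have := abs_nonneg v
        nlinarith [mul_nonneg (sq_nonneg (|v| - 1)) (by linarith : 0 ≤ |v| + 1)]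
      calc _ ≤ 2 * (1 + |v| ^ 3) * ‖g v‖ := by gcongr
        _ = 2 * ‖g v‖ + 2 * (|v| ^ 3 * ‖g v‖) := by ring
        _ ≤ 4 := by linarith [hg1 v, hg3 v]
    rw [h1, norm_mul]
    calc (1 + t ^ 2) * (‖F ↑(x + v)‖ * ‖g v‖)
        ≤ (τ ^ 2 * (1 + |v| ^ 2)) * ((K * (1 + |x|) * (1 + |v|)) * ‖g v‖) := by gcongr
      _ = τ ^ 2 * (K * (1 + |x|)) * ((1 + |v| ^ 2) * (1 + |v|) * ‖g v‖) := by ring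
      _ ≤ _ := by gcongr
  have hderiv : deriv h 0 = deriv F x / τ := by
    have h1 : HasDerivAt (fun z : ℂ => z / τ) (1 / τ : ℂ) 0 := (hasDerivAt_id (0 : ℂ)).div_const _
    have hx : (x : ℂ) + 0 / τ = x := by simp
    have h2 : HasDerivAt (fun z : ℂ => F (x + z / τ)) (deriv F x * (1 / τ)) 0 := by
      have := (hF (x + 0 / τ)).hasDerivAt.comp (0 : ℂ) (h1.const_add (x : ℂ))
      rwa [hx] at this
    have h3 : HasDerivAt (fun z : ℂ => g (z / τ)) (0 * (1 / τ)) 0 := by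
      have := (hg (0 / τ)).hasDerivAt.comp (0 : ℂ) h1
      rwa [zero_div, hg0'] at this
    have := (h2.mul h3).deriv
    rw [hh]
    refine this.trans ?_
    simp [hg0, div_eq_mul_inv]
  have key := hκ h _ _ hd hgrowth hdecay
  rw [hderiv, div_eq_iff hτC] at key
  rw [key, mul_comm]
  congr 2
  ext t
  simp [hh]

theorem exists_norm_le_linear_of_lintegral_lt_top {σ : ℝ} {F : ℂ → ℂ} (hσ : 0 ≤ σ)
    (hF : IsEntireOfExpType σ F) {p : ℝ} (hp : 1 ≤ p)
    (hint : ∫⁻ x : ℝ, ENNReal.ofReal ‖F x‖ ^ p < ∞) :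
    ∃ K, 0 ≤ K ∧ ∀ x : ℝ, ‖F x‖ ≤ K * (1 + |x|) := by
  obtain ⟨C, hC⟩ := hF.2 1 one_pos
  have hc : Continuous fun t : ℝ => F t := hF.1.continuous.comp Complex.continuous_ofReal
  have hp0 : 0 < p := one_pos.trans_le hp
  have hi : Integrable fun t : ℝ => ‖F t‖ ^ p := by
    refine ⟨(hc.norm.rpow_const fun _ => Or.inr hp0.le).aestronglyMeasurable, ?_⟩
    rw [hasFiniteIntegral_iff_ofReal (.of_forall fun t => by positivity)]
    simpa only [ENNReal.ofReal_rpow_of_nonneg (norm_nonneg _) hp0.le] using hint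
  refine exists_norm_le_linear hF.1 (b := σ + 1) (M := 1 + ∫ t : ℝ, ‖F t‖ ^ p) (by linarith) hC
    fun x hx => ?_
  have hJ : 0 ≤ ∫ t : ℝ, ‖F t‖ ^ p := integral_nonneg fun t => by positivity
  -- a crude substitute for Hölder's inequality, sufficient for `|x| ≥ 1`
  have hpt : ∀ t : ℝ, ‖F t‖ ≤ 1 + ‖F t‖ ^ p := by
    intro t
    rcases le_total ‖F t‖ 1 with h | h
    · have : 0 ≤ ‖F t‖ ^ p := by positivity
      linarith
    · have := Real.self_le_rpow_of_one_le h hp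
      linarith
  have hone : IntegrableOn (fun _ : ℝ => (1 : ℝ)) (Set.uIoc 0 x) :=
    (intervalIntegrable_const (a := 0) (b := x)).def'
  calc ‖∫ t in (0 : ℝ)..x, F t‖ ≤ ∫ t in Set.uIoc 0 x, ‖F t‖ :=
        intervalIntegral.norm_integral_le_integral_norm_uIoc
    _ ≤ ∫ t in Set.uIoc 0 x, (1 + ‖F t‖ ^ p) := by
        refine integral_mono (hc.norm.intervalIntegrable 0 x).def'
          (hone.add hi.integrableOn) hpt
    _ = |x| + ∫ t in Set.uIoc 0 x, ‖F t‖ ^ p := by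
        rw [integral_add hone hi.integrableOn]
        congr 1
        rw [setIntegral_const, smul_eq_mul, mul_one, measureReal_def, Real.volume_uIoc]
        simp
    _ ≤ |x| + ∫ t : ℝ, ‖F t‖ ^ p := by
        refine add_le_add le_rfl
          (setIntegral_le_integral hi (.of_forall fun t => ?_))
        exact Real.rpow_nonneg (norm_nonneg _) p
    _ ≤ (1 + ∫ t : ℝ, ‖F t‖ ^ p) * |x| := by nlinarith

/-- Weighted `L_p` bound for a function represented as an integral of translates, when the
multiplier `g` absorbs the growth of the weight `w`. -/
theorem lintegral_rpow_le_of_eq_integral_translates {w : ℝ → ℝ} (hw : Measurable w)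
    (hw0 : ∀ t, 0 < w t) (hsub : ∀ s t, w (s - t) ≤ w s * w t) {f d g κ : ℝ → ℂ} {C τ : ℝ}
    (hf : Measurable f) (hκ : Measurable κ) (hτ : 0 ≤ τ)
    (hg : ∀ t, ‖g t‖ * w t ≤ C)
    (hd : ∀ x, d x = τ * ∫ t : ℝ, f (x + t / τ) * g (t / τ) * κ t) {p : ℝ} (hp : 1 ≤ p) :
    ∫⁻ x, ENNReal.ofReal (w x * ‖d x‖) ^ p ≤
      (ENNReal.ofReal (τ * C) * ∫⁻ t, ‖κ t‖ₑ) ^ p * ∫⁻ x, ENNReal.ofReal (w x * ‖f x‖) ^ p := by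
  have hp0 : 0 ≤ p := by linarith
  set G : ℝ → ℝ≥0∞ := fun x => ENNReal.ofReal (w x * ‖f x‖) with hGdef
  have hG : Measurable G := (hw.mul hf.norm).ennreal_ofReal
  have hpt : ∀ x, ENNReal.ofReal (w x * ‖d x‖) ≤
      ENNReal.ofReal (τ * C) * ∫⁻ t, G (x + t / τ) * ‖κ t‖ₑ := by
    intro x
    rw [hd, norm_mul, Complex.norm_real, Real.norm_of_nonneg hτ,
      ENNReal.ofReal_mul (hw0 x).le, ENNReal.ofReal_mul hτ, ofReal_norm]
    calc ENNReal.ofReal (w x) * (ENNReal.ofReal τ * ‖∫ t, f (x + t / τ) * g (t / τ) * κ t‖ₑ)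
        ≤ ENNReal.ofReal (w x) *
            (ENNReal.ofReal τ * ∫⁻ t, ‖f (x + t / τ) * g (t / τ) * κ t‖ₑ) := by
          gcongr
          exact enorm_integral_le_lintegral_enorm _
      _ = ENNReal.ofReal τ *
            ∫⁻ t, ENNReal.ofReal (w x) * ‖f (x + t / τ) * g (t / τ) * κ t‖ₑ := by
          rw [lintegral_const_mul' _ _ ENNReal.ofReal_ne_top, mul_left_comm]
      _ ≤ ENNReal.ofReal τ * ∫⁻ t, ENNReal.ofReal C * (G (x + t / τ) * ‖κ t‖ₑ) := by
          refine mul_le_mul_right (lintegral_mono fun t => ?_) _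
          rw [enorm_mul, ← mul_assoc, ← mul_assoc]
          refine mul_le_mul_left ?_ _
          rw [hGdef, ← ofReal_norm, norm_mul, ← ENNReal.ofReal_mul (hw0 x).le,
            ← ENNReal.ofReal_mul ((mul_nonneg (norm_nonneg _) (hw0 (0 : ℝ)).le).trans (hg 0))]
          refine ENNReal.ofReal_le_ofReal ?_
          have h1 := hsub (x + t / τ) (t / τ)
          rw [add_sub_cancel_right] at h1
          calc w x * (‖f (x + t / τ)‖ * ‖g (t / τ)‖)
              ≤ (w (x + t / τ) * w (t / τ)) * (‖f (x + t / τ)‖ * ‖g (t / τ)‖) := by gcongr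
            _ = (‖g (t / τ)‖ * w (t / τ)) * (w (x + t / τ) * ‖f (x + t / τ)‖) := by ring
            _ ≤ C * (w (x + t / τ) * ‖f (x + t / τ)‖) := by
                have := hw0 (x + t / τ)
                gcongr
                exact hg _
      _ = _ := by
          rw [lintegral_const_mul' _ _ ENNReal.ofReal_ne_top, ENNReal.ofReal_mul hτ, mul_assoc]
  calc ∫⁻ x, ENNReal.ofReal (w x * ‖d x‖) ^ p
      ≤ ∫⁻ x, (ENNReal.ofReal (τ * C) * ∫⁻ t, G (x + t / τ) * ‖κ t‖ₑ) ^ p := by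
        gcongr with x
        exact hpt x
    _ = ENNReal.ofReal (τ * C) ^ p * ∫⁻ x, (∫⁻ t, G (x + t / τ) * ‖κ t‖ₑ) ^ p := by
        simp_rw [ENNReal.mul_rpow_of_nonneg _ _ hp0]
        rw [lintegral_const_mul' _ _ (ENNReal.rpow_ne_top_of_nonneg hp0 ENNReal.ofReal_ne_top)]
    _ ≤ ENNReal.ofReal (τ * C) ^ p * ((∫⁻ t, ‖κ t‖ₑ) ^ p * ∫⁻ x, G x ^ p) := by
        gcongr
        exact lintegral_rpow_lintegral_translate_le hG hκ.enorm (measurable_id.div_const τ) hp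
    _ = _ := by rw [← mul_assoc, ENNReal.mul_rpow_of_nonneg _ _ hp0]

theorem lintegral_rpow_le_of_forall_truncatedWeight {μ : ℝ → ℝ} (hμ : IsNonquasianalyticWeight μ)
    {d : ℝ → ℂ} (hd : Measurable d) {p : ℝ} {Q : ℝ≥0∞}
    (hQ : ∀ N : ℕ, ∫⁻ x, ENNReal.ofReal (truncatedWeight μ (2 ^ N) x * ‖d x‖) ^ p ≤ Q) :
    ∫⁻ x, ENNReal.ofReal (μ x * ‖d x‖) ^ p ≤ Q := by
  have hlim : ∀ x, Filter.Tendsto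
      (fun N : ℕ => ENNReal.ofReal (truncatedWeight μ (2 ^ N) x * ‖d x‖) ^ p) Filter.atTop
      (nhds (ENNReal.ofReal (μ x * ‖d x‖) ^ p)) := by
    intro x
    refine tendsto_const_nhds.congr' ?_
    filter_upwards [(tendsto_pow_atTop_atTop_of_one_lt (one_lt_two (α := ℝ))).eventually_ge_atTop
      |x|] with N hN
    rw [hμ.truncatedWeight_of_abs_le hN]
  calc ∫⁻ x, ENNReal.ofReal (μ x * ‖d x‖) ^ p
      = ∫⁻ x, Filter.liminf
          (fun N : ℕ => ENNReal.ofReal (truncatedWeight μ (2 ^ N) x * ‖d x‖) ^ p)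
            Filter.atTop := by
        congr 1
        ext x
        exact (hlim x).liminf_eq.symm
    _ ≤ Filter.liminf (fun N : ℕ => ∫⁻ x,
          ENNReal.ofReal (truncatedWeight μ (2 ^ N) x * ‖d x‖) ^ p) Filter.atTop :=
        lintegral_liminf_le fun N =>
          ((hμ.measurable_truncatedWeight.mul hd.norm).ennreal_ofReal).pow_const p
    _ ≤ Q := Filter.liminf_le_of_le (by isBoundedDefault) fun b hb => by
        obtain ⟨N, hN⟩ := hb.exists
        exact hN.trans (hQ N)

theorem continuous_of_mem_expTypeClass {σ : ℝ} {f : ℝ → ℂ} (hf : f ∈ expTypeClass σ) :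
    Continuous f := by
  obtain ⟨F, hF, hfF⟩ := hf
  rw [funext hfF]
  exact hF.1.continuous.comp Complex.continuous_ofReal

theorem deriv_mem_expTypeClass {σ : ℝ} (hσ : 0 ≤ σ) {f : ℝ → ℂ} (hf : f ∈ expTypeClass σ) :
    deriv f ∈ expTypeClass σ := by
  obtain ⟨F, hF, hfF⟩ := hf
  refine ⟨deriv F, isEntireOfExpType_deriv hσ hF, fun x => ?_⟩
  rw [funext hfF, deriv_comp_ofReal_of_differentiable hF.1]

/-- The weighted Bernstein inequality for the first derivative. -/
theorem IsNonquasianalyticWeight.exists_eLpNorm_deriv_le {μ : ℝ → ℝ}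
    (hμ : IsNonquasianalyticWeight μ) :
    ∃ c : ℝ, 0 < c ∧ ∀ p : ℝ, 1 ≤ p → ∀ σ : ℝ, 1 ≤ σ → ∀ f : ℝ → ℂ, f ∈ expTypeClass σ →
      MemLp f (ENNReal.ofReal p) (weightedVolume μ p) →
      eLpNorm (deriv f) (ENNReal.ofReal p) (weightedVolume μ p) ≤
        ENNReal.ofReal (c * σ) * eLpNorm f (ENNReal.ofReal p) (weightedVolume μ p) := by
  obtain ⟨κ, hκi, hκc, hκ⟩ := exists_integrable_kernel_deriv
  obtain ⟨A, C, hA, hC, hmult⟩ := hμ.exists_multiplier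
  set k := ∫ t, ‖κ t‖ with hk
  have hk0 : 0 ≤ k := integral_nonneg fun t => norm_nonneg _
  have hκk : ∫⁻ t, ‖κ t‖ₑ = ENNReal.ofReal k := (ofReal_integral_norm_eq_lintegral_enorm hκi).symm
  -- the summand `1` only makes the constant positive
  refine ⟨(2 + A) * C * k + 1, by positivity, fun p hp σ hσ f hf hfL => ?_⟩
  have hp0 : 0 < p := one_pos.trans_le hp
  have hdf := deriv_mem_expTypeClass (by linarith) hf
  have hfm := (continuous_of_mem_expTypeClass hf).measurable
  have hdm := (continuous_of_mem_expTypeClass hdf).measurable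
  obtain ⟨F, hF, hfF⟩ := hf
  obtain ⟨B, hB⟩ := hF.2 1 one_pos
  -- `F` grows at rate `σ + 1` and the multiplier at rate `A`, and `σ + 1 + A ≤ τ` for `σ ≥ 1`
  set τ := (2 + A) * σ with hτ
  have hτ1 : 1 ≤ τ := by nlinarith
  have hnorm := eLpNorm_weightedVolume hμ.measurable hμ.pos hp hfm
  have hfin : ∫⁻ x, ENNReal.ofReal (μ x * ‖f x‖) ^ p < ∞ := by
    have := hfL.eLpNorm_lt_top
    rw [hnorm] at this
    exact (ENNReal.rpow_lt_top_iff_of_pos (by positivity)).1 this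
  obtain ⟨K, hK, hFK⟩ := exists_norm_le_linear_of_lintegral_lt_top (by linarith) hF hp (by
    refine lt_of_le_of_lt (lintegral_mono fun x => ?_) hfin
    rw [hfF]
    gcongr
    exact le_mul_of_one_le_left (norm_nonneg _) (hμ.one_le x))
  set Q := (ENNReal.ofReal (τ * C) * ENNReal.ofReal k) ^ p *
    ∫⁻ x, ENNReal.ofReal (μ x * ‖f x‖) ^ p
  have hQ : ∫⁻ x, ENNReal.ofReal (μ x * ‖deriv f x‖) ^ p ≤ Q := by
    refine lintegral_rpow_le_of_forall_truncatedWeight hμ hdm fun N => ?_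
    obtain ⟨g, hg, hgA, hg0, hg0', hg1, hg3, hgC⟩ := hmult N
    have hR : (0 : ℝ) < 2 ^ N := by positivity
    have hrep : ∀ x, deriv f x =
        τ * ∫ t : ℝ, f (x + t / τ) * (fun v : ℝ => g v) (t / τ) * κ t := by
      intro x
      rw [funext hfF, deriv_comp_ofReal_of_differentiable hF.1]
      exact deriv_eq_integral_translates hκ hF.1 (by linarith) hB hK hFK hg hgA hg0 hg0' hg1 hg3
        hτ1 (by nlinarith) x
    have h := lintegral_rpow_le_of_eq_integral_translates (hμ.measurable_truncatedWeight)
      hμ.truncatedWeight_pos (hμ.truncatedWeight_sub_le hR) hfm hκc.measurable (by linarith) hgC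
      hrep hp
    rw [hκk] at h
    refine h.trans (mul_le_mul_right (lintegral_mono fun x => ?_) _)
    gcongr
    exact hμ.truncatedWeight_le hR x
  rw [hnorm, eLpNorm_weightedVolume hμ.measurable hμ.pos hp hdm]
  calc (∫⁻ x, ENNReal.ofReal (μ x * ‖deriv f x‖) ^ p) ^ (1 / p) ≤ Q ^ (1 / p) := by gcongr
    _ = ENNReal.ofReal (τ * C * k) * (∫⁻ x, ENNReal.ofReal (μ x * ‖f x‖) ^ p) ^ (1 / p) := by
        rw [ENNReal.mul_rpow_of_nonneg _ _ (by positivity), one_div,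
          ENNReal.rpow_rpow_inv hp0.ne', ← ENNReal.ofReal_mul (by positivity)]
    _ ≤ _ := by
        refine mul_le_mul_left (ENNReal.ofReal_le_ofReal ?_) _
        rw [hτ]
        nlinarith

theorem mainTheorem4 (μ : ℝ → ℝ) (hμ : IsNonquasianalyticWeight μ) (p : ℝ) (hp : 1 ≤ p) :
    ∃ c : ℕ → ℝ, (∀ n, 0 < c n) ∧
      ∀ σ : ℝ, 1 ≤ σ → ∀ f : ℝ → ℂ, f ∈ expTypeClass σ →
        MemLp f (ENNReal.ofReal p) (weightedVolume μ p) →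
        ∀ n : ℕ,
          MemLp (iteratedDeriv n f) (ENNReal.ofReal p) (weightedVolume μ p) ∧
          eLpNorm (iteratedDeriv n f) (ENNReal.ofReal p) (weightedVolume μ p) ≤
            ENNReal.ofReal (c n * σ ^ n) *
              eLpNorm f (ENNReal.ofReal p) (weightedVolume μ p) := by
  obtain ⟨c, hc, hderiv⟩ := hμ.exists_eLpNorm_deriv_le
  refine ⟨fun n => c ^ n, fun n => pow_pos hc n, fun σ hσ f hf hfL n => ?_⟩
  suffices h : iteratedDeriv n f ∈ expTypeClass σ ∧
      MemLp (iteratedDeriv n f) (ENNReal.ofReal p) (weightedVolume μ p) ∧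
      eLpNorm (iteratedDeriv n f) (ENNReal.ofReal p) (weightedVolume μ p) ≤
        ENNReal.ofReal (c ^ n * σ ^ n) * eLpNorm f (ENNReal.ofReal p) (weightedVolume μ p) from
    h.2
  induction n with
  | zero => simpa using ⟨hf, hfL⟩
  | succ n ih =>
    obtain ⟨h1, h2, h3⟩ := ih
    rw [iteratedDeriv_succ]
    have h4 := deriv_mem_expTypeClass (by linarith) h1
    have h5 := hderiv p hp σ hσ _ h1 h2
    refine ⟨h4, ⟨(continuous_of_mem_expTypeClass h4).aestronglyMeasurable, ?_⟩, ?_⟩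
    · exact h5.trans_lt (ENNReal.mul_lt_top ENNReal.ofReal_lt_top h2.eLpNorm_lt_top)
    · refine (h5.trans (mul_le_mul_right h3 _)).trans_eq ?_
      rw [← mul_assoc, ← ENNReal.ofReal_mul (by positivity)]
      congr 2
      ring
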